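/- Let $V$ be a finite set and let $G$ be a bi-directed graph on $V$, i.e. a simple graph without loops all of whose edges are written $v\leftrightarrow w$. Let $\mathbf P(G)$ be the set of symmetric positive definite matrices $\Sigma=(\sigma_{vw})\in\mathbb R^{V\times V}$ such that $\sigma_{vw}=0$ for all $v\ne w$ for which $v\leftrightarrow w$ is not an edge of $G$. For $A\subseteq V$, let $\mathrm{Bd}(A)$ be the union of $A$ and the set of all vertices adjacent to some vertex of $A$, and call $A$ simplicial if $\mathrm{Bd}(A)$ is complete, i.e. every two distinct vertices of $\mathrm{Bd}(A)$ are adjacent. Let $S\in\mathbb R^{V\times V}$ be symmetric positive definite, and let $\hat\Sigma\in\mathbf P(G)$ be a solution to the likelihood equations of the covariance graph model $\bigl(\mathcal N_V(0,\Sigma)\mid\Sigma\in\mathbf P(G)\bigr)$, that is, $$(\hat\Sigma^{-1})_{vw}=(\hat\Sigma^{-1}S\hat\Sigma^{-1})_{vw}\qquad\text{for all } v,w\in V \text{ with } v=w \text{ or } v\leftrightarrow w \text{ in } G .$$ Then for every simplicial set $A\subseteq V$, $\hat\Sigma_{A\times A}=S_{A\times A}$. -/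

import Mathlib

/-- The possible edges between an ordered pair `(v, w)` of vertices:
no edge, `v - w`, `v ← w`, `v → w`, `v ↔ w`. -/
inductive EdgeMark : Type
  | absent
  | undirected
  | leftArrow
  | rightArrow
  | bidirected

/-- A simple mixed graph with vertex set `V` (finiteness of `V` is imposed where graphs are used). -/
structure SimpleMixedGraph (V : Type*) where
  /-- the edge map -/
  edge : V → V → EdgeMark
  edge_self : ∀ v, edge v v = EdgeMark.absent
  edge_undirected : ∀ v w, edge v w = EdgeMark.undirected → edge v w = edge w v
  edge_bidirected : ∀ v w, edge v w = EdgeMark.bidirected → edge v w = edge w v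
  edge_directed : ∀ v w, edge v w = EdgeMark.rightArrow ↔ edge w v = EdgeMark.leftArrow

namespace SimpleMixedGraph

variable {V : Type*}

/-- Two vertices are adjacent if there is an edge of any type between them. -/
def Adj (G : SimpleMixedGraph V) (v w : V) : Prop :=
  G.edge v w ≠ EdgeMark.absent

/-- `v ↔ w` is an edge of `G`. -/
def BiAdj (G : SimpleMixedGraph V) (v w : V) : Prop :=
  G.edge v w = EdgeMark.bidirected

/-- A bi-directed graph contains only edges of type `↔`. -/
def IsBidirected (G : SimpleMixedGraph V) : Prop :=
  ∀ v w, G.Adj v w → G.BiAdj v w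

/-- The boundary `bd(v)` of a vertex. -/
def vertexBoundary (G : SimpleMixedGraph V) (v : V) : Set V :=
  {w | G.Adj v w}

/-- The boundary `bd(A)` of a vertex set. -/
def boundary (G : SimpleMixedGraph V) (A : Set V) : Set V :=
  (⋃ v ∈ A, G.vertexBoundary v) \ A

/-- The closed boundary `Bd(A) = bd(A) ∪ A`. -/
def closedBoundary (G : SimpleMixedGraph V) (A : Set V) : Set V :=
  G.boundary A ∪ A

/-- A vertex set is complete if every two distinct vertices in it are adjacent. -/
def IsComplete (G : SimpleMixedGraph V) (B : Set V) : Prop :=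
  ∀ v ∈ B, ∀ w ∈ B, v ≠ w → G.Adj v w

/-- A vertex set `A` is simplicial if `Bd(A)` is complete. -/
def IsSimplicial (G : SimpleMixedGraph V) (A : Set V) : Prop :=
  G.IsComplete (G.closedBoundary A)

/-- The cone `P(G)` of symmetric positive definite matrices whose off-diagonal entries
vanish at the pairs not joined by a bi-directed edge. -/
def covarianceCone (G : SimpleMixedGraph V) : Set (Matrix V V ℝ) :=
  {M | M.PosDef ∧ ∀ v w, v ≠ w → ¬ G.BiAdj v w → M v w = 0}

/-- The likelihood equations of the covariance graph model of `G` with empirical covariance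
matrix `S`. -/
def LikelihoodEquations [Fintype V] [DecidableEq V] (G : SimpleMixedGraph V)
    (S M : Matrix V V ℝ) : Prop :=
  ∀ v w, v = w ∨ G.BiAdj v w → (M⁻¹) v w = (M⁻¹ * S * M⁻¹) v w

/-- `M` is a solution to the likelihood equations of the covariance graph model of `G`:
it lies in `P(G)` and satisfies the equations. -/
def IsLikelihoodSolution [Fintype V] [DecidableEq V] (G : SimpleMixedGraph V)
    (S M : Matrix V V ℝ) : Prop :=
  M ∈ G.covarianceCone ∧ G.LikelihoodEquations S M

end SimpleMixedGraph

/-!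
Put `M = Σ̂⁻¹ - Σ̂⁻¹ S Σ̂⁻¹`. The likelihood equations say that `M` vanishes on the diagonal and on
the edges of `G`, while invertibility of `Σ̂` gives `Σ̂ M Σ̂ = Σ̂ - S`. In the expansion
`(Σ̂ M Σ̂)_{ab} = ∑_{v,w} σ̂_{av} M_{vw} σ̂_{wb}` with `a, b ∈ A`, the sparsity of `Σ̂` leaves only
terms with `v, w ∈ Bd(A)` (`SimpleMixedGraph.mem_closedBoundary_of_apply_ne_zero`). As `Bd(A)` is
complete, every such pair is on the diagonal or an edge, so `M_{vw} = 0` and the sum vanishes.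
-/

namespace SimpleMixedGraph

variable {V : Type*} {G : SimpleMixedGraph V}

theorem BiAdj.adj {v w : V} (h : G.BiAdj v w) : G.Adj v w := by
  unfold Adj BiAdj at *
  simp [h]

theorem mem_closedBoundary_of_mem {A : Set V} {a : V} (ha : a ∈ A) : a ∈ G.closedBoundary A :=
  Or.inr ha

theorem mem_closedBoundary_of_adj {A : Set V} {a v : V} (ha : a ∈ A) (h : G.Adj a v) :
    v ∈ G.closedBoundary A := by
  by_cases hv : v ∈ A
  · exact mem_closedBoundary_of_mem hv
  · exact Or.inl ⟨Set.mem_biUnion ha h, hv⟩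

/-- The rows indexed by `A` of a matrix in `P(G)` are supported in the columns `Bd(A)`. -/
theorem mem_closedBoundary_of_apply_ne_zero {M : Matrix V V ℝ} (hM : M ∈ G.covarianceCone)
    {A : Set V} {a v : V} (ha : a ∈ A) (h : M a v ≠ 0) : v ∈ G.closedBoundary A := by
  by_cases hav : a = v
  · exact hav ▸ mem_closedBoundary_of_mem ha
  · by_cases hb : G.BiAdj a v
    · exact mem_closedBoundary_of_adj ha hb.adj
    · exact absurd (hM.2 a v hav hb) h

theorem apply_comm_of_mem_covarianceCone {M : Matrix V V ℝ} (hM : M ∈ G.covarianceCone)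
    (v w : V) : M v w = M w v := by
  simpa using hM.1.isHermitian.apply w v

/-- Two-sided multiplication by a matrix of `P(G)` only sees, in the rows and columns indexed by
`A`, the entries of the middle factor indexed by `Bd(A)`. -/
theorem mul_mul_apply_eq_zero [Fintype V] {M N : Matrix V V ℝ} (hM : M ∈ G.covarianceCone)
    {A : Set V} (hN : ∀ v ∈ G.closedBoundary A, ∀ w ∈ G.closedBoundary A, N v w = 0)
    {a b : V} (ha : a ∈ A) (hb : b ∈ A) : (M * N * M) a b = 0 := by
  simp only [Matrix.mul_apply, Finset.sum_mul]
  refine Finset.sum_eq_zero fun w _ => Finset.sum_eq_zero fun v _ => ?_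
  by_cases hv : M a v = 0
  · simp [hv]
  by_cases hw : M b w = 0
  · simp [apply_comm_of_mem_covarianceCone hM w b, hw]
  rw [hN v (mem_closedBoundary_of_apply_ne_zero hM ha hv) w
    (mem_closedBoundary_of_apply_ne_zero hM hb hw)]
  simp

end SimpleMixedGraph

theorem mainTheorem6 {V : Type*} [Fintype V] [DecidableEq V]
    (G : SimpleMixedGraph V) (hG : G.IsBidirected)
    (A : Set V) (hA : G.IsSimplicial A)
    (S : Matrix V V ℝ) (hS : S.PosDef)
    (SigmaHat : Matrix V V ℝ) (hSigma : G.IsLikelihoodSolution S SigmaHat) :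
    SigmaHat.submatrix (Subtype.val : A → V) (Subtype.val : A → V) =
      S.submatrix (Subtype.val : A → V) (Subtype.val : A → V) := by
  obtain ⟨hcone, heq⟩ := hSigma
  have hdet : IsUnit SigmaHat.det := hcone.1.det_pos.ne'.isUnit
  have hfactor : SigmaHat * (SigmaHat⁻¹ - SigmaHat⁻¹ * S * SigmaHat⁻¹) * SigmaHat =
      SigmaHat - S := by
    rw [Matrix.mul_sub, Matrix.sub_mul, Matrix.mul_nonsing_inv _ hdet, Matrix.one_mul,
      Matrix.mul_assoc SigmaHat⁻¹ S, Matrix.mul_nonsing_inv_cancel_left _ _ hdet,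
      Matrix.nonsing_inv_mul_cancel_right _ _ hdet]
  have hzero : ∀ v ∈ G.closedBoundary A, ∀ w ∈ G.closedBoundary A,
      (SigmaHat⁻¹ - SigmaHat⁻¹ * S * SigmaHat⁻¹) v w = 0 := by
    intro v hv w hw
    rw [Matrix.sub_apply, sub_eq_zero]
    apply heq
    by_cases hvw : v = w
    · exact Or.inl hvw
    · exact Or.inr (hG v w (hA v hv w hw hvw))
  ext a b
  have h := SimpleMixedGraph.mul_mul_apply_eq_zero hcone hzero a.2 b.2
  rw [hfactor, Matrix.sub_apply, sub_eq_zero] at h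
  exact h
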